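/- Let $k$ be a field and let $f\in k[x,y]\setminus k$. A dicritical divisor of $f$ is a discrete valuation ring $R_v$ with quotient field $k(x,y)$ such that $k[x,y]\not\subseteq R_v$, $k(f)\subseteq R_v$, and the residue $\mathrm{Res}(f)$ of $f$ in the residue field $K_v=R_v/\mathfrak{m}_v$ is transcendental over $k$ (here $k\subseteq k(f)\subseteq R_v$, so $K_v$ is an extension field of $k$). Let $R_v$ be a dicritical divisor of $f$, and let $k'$ be the relative algebraic closure of $k$ in $K_v$. Then there is an element $t\in K_v$, transcendental over $k$, such that $K_v=k'(t)$ and $\mathrm{Res}(f)\in k'[t]$. -/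

import Mathlib

open scoped IntermediateField

noncomputable section

/-- The rational function field `k(x,y)`. -/
abbrev RatFunc₂ (k : Type*) [Field k] : Type _ :=
  FractionRing (MvPolynomial (Fin 2) k)

/-- The polynomial `f ∈ k[x,y]` viewed in `k(x,y)`. -/
abbrev toRat {k : Type*} [Field k] (f : MvPolynomial (Fin 2) k) : RatFunc₂ k :=
  algebraMap (MvPolynomial (Fin 2) k) (RatFunc₂ k) f

/-- The inclusion `k → V` when `V` is a valuation ring of `k(x,y)` that contains a subfield
`F` of `k(x,y)` over `k`. -/
def constHom {k : Type*} [Field k] (F : IntermediateField k (RatFunc₂ k))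
    (V : ValuationSubring (RatFunc₂ k)) (hF : (F : Set (RatFunc₂ k)) ⊆ V) : k →+* V :=
  (algebraMap k (RatFunc₂ k)).codRestrict V fun c => hF (F.algebraMap_mem c)

/-- The residue field of `V` as an extension of `k`, through `k ⊆ F ⊆ V`. -/
abbrev residueAlgebra {k : Type*} [Field k] (F : IntermediateField k (RatFunc₂ k))
    (V : ValuationSubring (RatFunc₂ k)) (hF : (F : Set (RatFunc₂ k)) ⊆ V) :
    Algebra k (IsLocalRing.ResidueField V) :=
  ((IsLocalRing.residue V).comp (constHom F V hF)).toAlgebra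

/-- The residue in `V / 𝔪_V` of a polynomial `f` with `k(f) ⊆ V`. -/
def resPoly {k : Type*} [Field k] (f : MvPolynomial (Fin 2) k)
    (V : ValuationSubring (RatFunc₂ k))
    (hf : (k⟮toRat f⟯ : Set (RatFunc₂ k)) ⊆ V) : IsLocalRing.ResidueField V :=
  IsLocalRing.residue V ⟨toRat f, hf (IntermediateField.mem_adjoin_simple_self k (toRat f))⟩

/-- `V` is a dicritical divisor of `f`: a discrete valuation ring with quotient field `k(x,y)`
such that `k[x,y] ⊄ V`, `k(f) ⊆ V`, and the residue of `f` is transcendental over `k`. -/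
structure IsDicriticalDivisor {k : Type*} [Field k] (f : MvPolynomial (Fin 2) k)
    (V : ValuationSubring (RatFunc₂ k)) : Prop where
  isDVR : IsDiscreteValuationRing V
  not_subset : ¬ (Set.range (toRat (k := k)) ⊆ V)
  adjoin_subset : (k⟮toRat f⟯ : Set (RatFunc₂ k)) ⊆ V
  transcendental :
    letI : Algebra k (IsLocalRing.ResidueField V) := residueAlgebra k⟮toRat f⟯ V adjoin_subset
    Transcendental k (resPoly f V adjoin_subset)

end

/-!
One of the two generators, say `x`, lies outside `V`, so `x⁻¹` has residue `0` and the residue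
field of `V ∩ K`, where `K = k(x)`, is `k`. Inside `K(y) = k(x, y)`, the nonzero elements having a
power that is an element of `K` times a unit of algebraic residue form a group. Some polynomial in
`y` over `K` lies outside it; let `φ` be one of least degree. The coefficients of a `φ`-adic
expansion lie in the group, and collecting the terms of least value shows that every polynomial in
`y` is a monomial `φ ^ i * w`, with `w` in the group and `0 ≤ i`, up to a factor whose residue lies
in `1 + t k'[t]`. Here `t` is the residue of the unit `φ ^ e * w` with the least exponent `e > 0`:
it is transcendental over `k`, and the residue of any other such unit is a power of `t` times an
element of `k'`. Quotients of polynomials then give the whole residue field `k'(t)`, and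
polynomials themselves, having `0 ≤ i`, have residues in `k'[t]`.
-/

open IsLocalRing Polynomial

section Residues

variable {L : Type*} [Field L] {V : ValuationSubring L}

/-- `u` lies in `V` and has residue `a`: the place of `L` attached to `V`, encoded as a relation so
that elements outside `V` need no junk value. -/
def HasResidue (V : ValuationSubring L) (u : L) (a : ResidueField V) : Prop :=
  ∃ v : V, (v : L) = u ∧ residue V v = a

namespace HasResidue

variable {u v : L} {a b : ResidueField V}

theorem unique (ha : HasResidue V u a) (hb : HasResidue V u b) : a = b := by
  obtain ⟨v, rfl, rfl⟩ := ha
  obtain ⟨w, hwv, rfl⟩ := hb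
  rw [Subtype.ext hwv]

theorem zero : HasResidue V 0 0 := ⟨0, rfl, map_zero _⟩

theorem one : HasResidue V 1 1 := ⟨1, rfl, map_one _⟩

theorem add (hu : HasResidue V u a) (hv : HasResidue V v b) : HasResidue V (u + v) (a + b) := by
  obtain ⟨u, rfl, rfl⟩ := hu
  obtain ⟨v, rfl, rfl⟩ := hv
  exact ⟨u + v, rfl, map_add _ _ _⟩

theorem mul (hu : HasResidue V u a) (hv : HasResidue V v b) : HasResidue V (u * v) (a * b) := by
  obtain ⟨u, rfl, rfl⟩ := hu
  obtain ⟨v, rfl, rfl⟩ := hv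
  exact ⟨u * v, rfl, map_mul _ _ _⟩

theorem pow (hu : HasResidue V u a) (n : ℕ) : HasResidue V (u ^ n) (a ^ n) := by
  obtain ⟨u, rfl, rfl⟩ := hu
  exact ⟨u ^ n, rfl, map_pow _ _ _⟩

theorem ne_zero (hu : HasResidue V u a) (ha : a ≠ 0) : u ≠ 0 := by
  rintro rfl
  exact ha (hu.unique zero)

theorem inv (hu : HasResidue V u a) (ha : a ≠ 0) : HasResidue V u⁻¹ a⁻¹ := by
  obtain ⟨v, rfl, rfl⟩ := hu
  obtain ⟨c, rfl⟩ := (residue_ne_zero_iff_isUnit v).1 ha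
  exact ⟨↑c⁻¹, map_units_inv V.subtype c, map_units_inv (residue V) c⟩

theorem div (hu : HasResidue V u a) (hv : HasResidue V v b) (hb : b ≠ 0) :
    HasResidue V (u / v) (a / b) := by
  simpa only [div_eq_mul_inv] using hu.mul (hv.inv hb)

theorem zpow (hu : HasResidue V u a) (ha : a ≠ 0) (m : ℤ) : HasResidue V (u ^ m) (a ^ m) := by
  obtain ⟨n, rfl | rfl⟩ := m.eq_nat_or_neg
  · simpa only [zpow_natCast] using hu.pow n
  · simpa only [zpow_neg, zpow_natCast] using (hu.pow n).inv (pow_ne_zero n ha)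

theorem inv_of_notMem (hu : u ∉ V) : HasResidue V u⁻¹ 0 := by
  have huV : u⁻¹ ∈ V := (V.mem_or_inv_mem u).resolve_left hu
  refine ⟨⟨u⁻¹, huV⟩, rfl, ?_⟩
  by_contra h
  obtain ⟨v, hv, -⟩ := inv (V := V) ⟨⟨u⁻¹, huV⟩, rfl, rfl⟩ h
  exact hu (inv_inv u ▸ hv ▸ v.2)

theorem aeval {k : Type*} [CommSemiring k] [Algebra k L] [Algebra k (ResidueField V)]
    (hk : ∀ c : k, HasResidue V (algebraMap k L c) (algebraMap k _ c))
    (hu : HasResidue V u a) (p : k[X]) : HasResidue V (aeval u p) (aeval a p) := by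
  induction p using Polynomial.induction_on' with
  | add p q hp hq => simpa only [map_add] using hp.add hq
  | monomial n c => simpa only [aeval_monomial] using (hk c).mul (hu.pow n)

end HasResidue

theorem exists_hasResidue_or_inv (V : ValuationSubring L) (u : L) :
    (∃ a, HasResidue V u a) ∨ HasResidue V u⁻¹ 0 := by
  by_cases hu : u ∈ V
  · exact .inl ⟨_, ⟨u, hu⟩, rfl, rfl⟩
  · exact .inr (.inv_of_notMem hu)

end Residues

section ResiduallyAlgebraic

variable {k K L : Type*} [Field k] [Field K] [Field L] [Algebra K L] {V : ValuationSubring L}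
  [Algebra k (ResidueField V)]

variable (k K V) in
/-- The residue field of `V ∩ K` is algebraic over `k`. The field `k` only has to act on the residue
field of `V`; it need not be contained in `K`. -/
def HasAlgebraicResidues : Prop :=
  ∀ (c : K) (a : ResidueField V), HasResidue V (algebraMap K L c) a → IsAlgebraic k a

variable (k K V) in
/-- Some positive power of `u` is, up to a factor from `K`, a unit of `V` whose residue is algebraic
over `k`. These elements form a subgroup of `Lˣ` that contains `Kˣ` and is closed under roots. -/
def IsResiduallyAlgebraic (u : L) : Prop :=
  ∃ n > 0, ∃ c : K, ∃ a ≠ 0, a ∈ algebraicClosure k (ResidueField V) ∧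
    HasResidue V (u ^ n * algebraMap K L c) a

theorem HasResidue.isResiduallyAlgebraic {u : L} {a : ResidueField V} (hu : HasResidue V u a)
    (ha : a ≠ 0) (hka : IsAlgebraic k a) : IsResiduallyAlgebraic k K V u :=
  ⟨1, one_pos, 1, a, ha, mem_algebraicClosure_iff.2 hka,
    by simpa only [pow_one, map_one, mul_one] using hu⟩

theorem isResiduallyAlgebraic_algebraMap {c : K} (hc : c ≠ 0) :
    IsResiduallyAlgebraic k K V (algebraMap K L c) := by
  refine ⟨1, one_pos, c⁻¹, 1, one_ne_zero, one_mem _, ?_⟩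
  rw [pow_one, ← map_mul, mul_inv_cancel₀ hc, map_one]
  exact .one

namespace IsResiduallyAlgebraic

variable {u v : L}

theorem ne_zero (hu : IsResiduallyAlgebraic k K V u) : u ≠ 0 := by
  rintro rfl
  obtain ⟨n, hn, c, a, ha, -, h⟩ := hu
  exact h.ne_zero ha (by rw [zero_pow hn.ne', zero_mul])

theorem mul (hu : IsResiduallyAlgebraic k K V u) (hv : IsResiduallyAlgebraic k K V v) :
    IsResiduallyAlgebraic k K V (u * v) := by
  obtain ⟨m, hm, c, a, ha, hka, hua⟩ := hu
  obtain ⟨n, hn, d, b, hb, hkb, hvb⟩ := hv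
  refine ⟨m * n, Nat.mul_pos hm hn, c ^ n * d ^ m, a ^ n * b ^ m,
    mul_ne_zero (pow_ne_zero n ha) (pow_ne_zero m hb),
    mul_mem (pow_mem hka n) (pow_mem hkb m), ?_⟩
  convert (hua.pow n).mul (hvb.pow m) using 1
  simp only [map_mul, map_pow]
  ring

theorem zpow (hu : IsResiduallyAlgebraic k K V u) (m : ℤ) :
    IsResiduallyAlgebraic k K V (u ^ m) := by
  obtain ⟨n, hn, c, a, ha, hka, h⟩ := hu
  refine ⟨n, hn, c ^ m, a ^ m, zpow_ne_zero m ha, zpow_mem hka m, ?_⟩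
  convert h.zpow ha m using 1
  rw [map_zpow₀, mul_zpow, ← zpow_natCast, ← zpow_natCast, zpow_comm]

theorem inv (hu : IsResiduallyAlgebraic k K V u) : IsResiduallyAlgebraic k K V u⁻¹ := by
  simpa only [zpow_neg_one] using hu.zpow (-1)

theorem div (hu : IsResiduallyAlgebraic k K V u) (hv : IsResiduallyAlgebraic k K V v) :
    IsResiduallyAlgebraic k K V (u / v) := by
  simpa only [div_eq_mul_inv] using hu.mul hv.inv

theorem of_pow {n : ℕ} (hn : 0 < n) (hu : IsResiduallyAlgebraic k K V (u ^ n)) :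
    IsResiduallyAlgebraic k K V u := by
  obtain ⟨m, hm, c, a, ha, hka, h⟩ := hu
  exact ⟨n * m, Nat.mul_pos hn hm, c, a, ha, hka, by rwa [pow_mul]⟩

theorem isAlgebraic (hK : HasAlgebraicResidues k K V) (hu : IsResiduallyAlgebraic k K V u)
    {a : ResidueField V} (hua : HasResidue V u a) : IsAlgebraic k a := by
  rcases eq_or_ne a 0 with rfl | ha
  · exact isAlgebraic_zero
  obtain ⟨n, hn, c, b, hb, hkb, h⟩ := hu
  have hun := pow_ne_zero n (hua.ne_zero ha)
  have hc : HasResidue V (algebraMap K L c) (b / a ^ n) := by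
    simpa only [mul_div_cancel_left₀ _ hun] using h.div (hua.pow n) (pow_ne_zero n ha)
  have han : a ^ n = b / (b / a ^ n) := (div_div_cancel₀ hb).symm
  refine IsAlgebraic.of_pow hn (mem_algebraicClosure_iff.1 ?_)
  rw [han]
  exact div_mem hkb (mem_algebraicClosure_iff.2 (hK c _ hc))

end IsResiduallyAlgebraic

end ResiduallyAlgebraic

section Monomials

variable {k K L : Type*} [Field k] [Field K] [Field L] [Algebra K L] {V : ValuationSubring L}
  [Algebra k (ResidueField V)] {z : L}

variable (k K V) in
/-- The exponents `i` for which some `z ^ i * w`, with `w` residually algebraic, is a unit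
of `V`. -/
def unitExponents (hz : z ≠ 0) : AddSubgroup ℤ where
  carrier := {i | ∃ w, IsResiduallyAlgebraic k K V w ∧ ∃ a ≠ 0, HasResidue V (z ^ i * w) a}
  zero_mem' := ⟨1, HasResidue.one.isResiduallyAlgebraic one_ne_zero isAlgebraic_one, 1, one_ne_zero,
    by simpa only [zpow_zero, mul_one] using HasResidue.one⟩
  add_mem' := by
    rintro i j ⟨w, hw, a, ha, hwa⟩ ⟨w', hw', b, hb, hwb⟩
    refine ⟨w * w', hw.mul hw', a * b, mul_ne_zero ha hb, ?_⟩
    rw [zpow_add₀ hz, mul_mul_mul_comm]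
    exact hwa.mul hwb
  neg_mem' := by
    rintro i ⟨w, hw, a, ha, hwa⟩
    refine ⟨w⁻¹, hw.inv, a⁻¹, inv_ne_zero ha, ?_⟩
    rw [zpow_neg, ← mul_inv]
    exact hwa.inv ha

variable (k K V) in
/-- `t` is the residue of a unit `z ^ e * w`, with `w` residually algebraic, whose exponent `e`
generates the group of all such exponents. -/
structure IsMonomialGenerator (hz : z ≠ 0) (e : ℕ) (w : L) (t : ResidueField V) : Prop where
  unitExponents_eq : unitExponents k K V hz = AddSubgroup.zmultiples (e : ℤ)
  isResiduallyAlgebraic : IsResiduallyAlgebraic k K V w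
  ne_zero : t ≠ 0
  hasResidue : HasResidue V (z ^ e * w) t

theorem exists_isMonomialGenerator (hz : z ≠ 0) :
    ∃ e w t, IsMonomialGenerator k K V hz e w t := by
  obtain ⟨g, hg⟩ := Int.subgroup_cyclic (unitExponents k K V hz)
  rw [← AddSubgroup.zmultiples_eq_closure, ← Int.zmultiples_natAbs] at hg
  obtain ⟨w, hw, t, ht, hwt⟩ : (g.natAbs : ℤ) ∈ unitExponents k K V hz :=
    hg ▸ AddSubgroup.mem_zmultiples _
  exact ⟨g.natAbs, w, t, hg, hw, ht, by rwa [zpow_natCast] at hwt⟩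

namespace IsMonomialGenerator

variable {hz : z ≠ 0} {e : ℕ} {w : L} {t : ResidueField V}

theorem pos (h : IsMonomialGenerator k K V hz e w t) (hne : unitExponents k K V hz ≠ ⊥) :
    0 < e := by
  refine Nat.pos_of_ne_zero fun he => hne ?_
  rw [h.unitExponents_eq, he, Nat.cast_zero, AddSubgroup.zmultiples_zero_eq_bot]

theorem transcendental (h : IsMonomialGenerator k K V hz e w t) (he : 0 < e)
    (hz' : ¬ IsResiduallyAlgebraic k K V z) : Transcendental k t := by
  intro ht
  have hw := h.isResiduallyAlgebraic
  have hzw : IsResiduallyAlgebraic k K V (z ^ e * w) :=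
    h.hasResidue.isResiduallyAlgebraic h.ne_zero ht
  refine hz' (.of_pow he ?_)
  simpa only [mul_div_cancel_right₀ _ hw.ne_zero] using hzw.div hw

theorem exists_eq_mul_zpow (h : IsMonomialGenerator k K V hz e w t)
    (hK : HasAlgebraicResidues k K V) {i : ℤ} {v : L} (hv : IsResiduallyAlgebraic k K V v)
    {b : ResidueField V} (hb : b ≠ 0) (hres : HasResidue V (z ^ i * v) b) :
    ∃ (β : algebraicClosure k (ResidueField V)) (m : ℤ), i = e * m ∧ b = β * t ^ m := by
  have hi : i ∈ unitExponents k K V hz := ⟨v, hv, b, hb, hres⟩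
  rw [h.unitExponents_eq] at hi
  obtain ⟨m, rfl⟩ := Int.mem_zmultiples_iff.1 hi
  have ht := zpow_ne_zero m h.ne_zero
  have hvw : HasResidue V (v / w ^ m) (b / t ^ m) := by
    convert hres.div (h.hasResidue.zpow h.ne_zero m) ht using 1
    rw [mul_zpow, zpow_mul, zpow_natCast, mul_div_mul_left _ _ (zpow_ne_zero m (pow_ne_zero e hz))]
  exact ⟨⟨b / t ^ m, mem_algebraicClosure_iff.2
    ((hv.div (h.isResiduallyAlgebraic.zpow m)).isAlgebraic hK hvw)⟩, m, rfl,
    (div_mul_cancel₀ b ht).symm⟩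

end IsMonomialGenerator

end Monomials

section LeadingMonomials

variable {k K L : Type*} [Field k] [Field K] [Field L] [Algebra K L] {V : ValuationSubring L}
  [Algebra k (ResidueField V)] {N : NonUnitalSubsemiring (ResidueField V)} {z : L}

variable (k K) in
/-- `u` is a monomial `z ^ i * w`, with `w` residually algebraic, up to a factor with residue
in `1 + N`. -/
def HasLeadingMonomial (N : NonUnitalSubsemiring (ResidueField V)) (z u : L) (i : ℤ) : Prop :=
  ∃ w n, IsResiduallyAlgebraic k K V w ∧ n ∈ N ∧ HasResidue V (u / (z ^ i * w)) (1 + n)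

variable (k K) in
/-- The residues of units `z ^ i * w` with `0 < i` and `w` residually algebraic lie in `N`. -/
def ContainsMonomialResidues (N : NonUnitalSubsemiring (ResidueField V)) (z : L) : Prop :=
  ∀ i : ℤ, 0 < i → ∀ w, IsResiduallyAlgebraic k K V w → ∀ b ≠ 0,
    HasResidue V (z ^ i * w) b → b ∈ N

theorem IsResiduallyAlgebraic.hasLeadingMonomial {u : L} (hu : IsResiduallyAlgebraic k K V u) :
    HasLeadingMonomial k K N z u 0 := by
  refine ⟨u, 0, hu, zero_mem N, ?_⟩
  rw [zpow_zero, one_mul, div_self hu.ne_zero, add_zero]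
  exact .one

namespace HasLeadingMonomial

variable {u v : L} {i j : ℤ}

theorem mul_left (hz : z ≠ 0) (hu : HasLeadingMonomial k K N z u i) :
    HasLeadingMonomial k K N z (z * u) (i + 1) := by
  obtain ⟨w, n, hw, hn, hres⟩ := hu
  refine ⟨w, n, hw, hn, ?_⟩
  rwa [zpow_add_one₀ hz, mul_comm _ z, mul_assoc, mul_div_mul_left _ _ hz]

theorem add_residuallyAlgebraic (hN : ContainsMonomialResidues k K N z) (hz : z ≠ 0)
    (hu : HasLeadingMonomial k K N z u i) (hi : 0 < i) {s : L}
    (hs : IsResiduallyAlgebraic k K V s) :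
    HasLeadingMonomial k K N z (u + s) 0 ∨ HasLeadingMonomial k K N z (u + s) i := by
  obtain ⟨w, n, hw, hn, hres⟩ := hu
  have hm0 : z ^ i * w ≠ 0 := mul_ne_zero (zpow_ne_zero i hz) hw.ne_zero
  have hs0 := hs.ne_zero
  rcases exists_hasResidue_or_inv V (z ^ i * w / s) with ⟨b, hb⟩ | h0
  · have hbN : b ∈ N := by
      rcases eq_or_ne b 0 with rfl | hb0
      · exact zero_mem N
      · exact hN i hi _ (hw.div hs) b hb0 (by rwa [← mul_div_assoc])
    refine .inl ⟨s, b + n * b, hs, add_mem hbN (mul_mem hn hbN), ?_⟩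
    convert (hres.mul hb).add .one using 1
    · rw [zpow_zero, one_mul, div_mul_div_cancel₀ hm0, add_div, div_self hs0]
    · ring
  · refine .inr ⟨w, n, hw, hn, ?_⟩
    rw [inv_div] at h0
    simpa only [add_div, add_zero] using hres.add h0

theorem exists_hasResidue_div (hN : ∀ n ∈ N, 1 + n ≠ 0) (hz : z ≠ 0)
    (hu : HasLeadingMonomial k K N z u i) (hv : HasLeadingMonomial k K N z v j)
    {b : ResidueField V} (hb : HasResidue V (u / v) b) :
    ∃ w, IsResiduallyAlgebraic k K V w ∧ ∃ n ∈ N, ∃ n' ∈ N,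
      HasResidue V (z ^ (i - j) * w) (b * (1 + n') / (1 + n)) := by
  obtain ⟨w, n, hw, hn, hwn⟩ := hu
  obtain ⟨w', n', hw', hn', hwn'⟩ := hv
  refine ⟨w / w', hw.div hw', n, hn, n', hn', ?_⟩
  convert (hb.mul hwn').div hwn (hN n hn) using 1
  have hu0 : u ≠ 0 := (div_ne_zero_iff.1 (hwn.ne_zero (hN n hn))).1
  have hv0 : v ≠ 0 := (div_ne_zero_iff.1 (hwn'.ne_zero (hN n' hn'))).1
  have hw0 := hw.ne_zero
  have hw0' := hw'.ne_zero
  rw [zpow_sub₀ hz]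
  field_simp

end HasLeadingMonomial

end LeadingMonomials

section KeyPolynomials

variable {k K L : Type*} [Field k] [Field K] [Field L] [Algebra K L] {V : ValuationSubring L}
  [Algebra k (ResidueField V)] {y : L} {φ : K[X]}

variable (k V) in
/-- `φ` has the least degree among the polynomials whose value at `y` is nonzero and not residually
algebraic; it plays the role of a key polynomial in the sense of MacLane. -/
structure IsKeyPolynomial (y : L) (φ : K[X]) : Prop where
  aeval_ne_zero : aeval y φ ≠ 0
  not_isResiduallyAlgebraic : ¬ IsResiduallyAlgebraic k K V (aeval y φ)
  isResiduallyAlgebraic_of_degree_lt : ∀ r : K[X], r.degree < φ.degree → aeval y r ≠ 0 →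
    IsResiduallyAlgebraic k K V (aeval y r)

theorem exists_hasResidue_aeval_div (hy : IntermediateField.adjoin K {y} = ⊤)
    (b : ResidueField V) : ∃ p q : K[X], HasResidue V (aeval y p / aeval y q) b := by
  obtain ⟨u, rfl⟩ := residue_surjective b
  have hu : (u : L) ∈ IntermediateField.adjoin K {y} := hy ▸ IntermediateField.mem_top
  obtain ⟨p, q, hpq⟩ := (IntermediateField.mem_adjoin_simple_iff K _).1 hu
  exact ⟨p, q, u, hpq, rfl⟩

theorem exists_isKeyPolynomial (hK : HasAlgebraicResidues k K V)
    (hy : IntermediateField.adjoin K {y} = ⊤) (hκ : ¬ Algebra.IsAlgebraic k (ResidueField V)) :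
    ∃ φ : K[X], IsKeyPolynomial k V y φ := by
  let S : Set K[X] := {p | aeval y p ≠ 0 ∧ ¬ IsResiduallyAlgebraic k K V (aeval y p)}
  have hS : S.Nonempty := by
    by_contra! hS
    have hRA : ∀ p : K[X], aeval y p ≠ 0 → IsResiduallyAlgebraic k K V (aeval y p) :=
      fun p hp => of_not_not fun hnot => (Set.eq_empty_iff_forall_notMem.1 hS p) ⟨hp, hnot⟩
    refine hκ ⟨fun b => ?_⟩
    rcases eq_or_ne b 0 with rfl | hb
    · exact isAlgebraic_zero
    obtain ⟨p, q, hpq⟩ := exists_hasResidue_aeval_div hy b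
    obtain ⟨hp, hq⟩ := div_ne_zero_iff.1 (hpq.ne_zero hb)
    exact ((hRA p hp).div (hRA q hq)).isAlgebraic hK hpq
  obtain ⟨φ, ⟨hφ0, hφ⟩, hmin⟩ := (InvImage.wf (degree (R := K)) wellFounded_lt).has_min S hS
  exact ⟨φ, hφ0, hφ, fun r hr hr0 => of_not_not fun hnot => hmin r ⟨hr0, hnot⟩ hr⟩

namespace IsKeyPolynomial

theorem degree_pos (hφ : IsKeyPolynomial k V y φ) : 0 < φ.degree := by
  by_contra! hle
  obtain ⟨hφ0, hnot, -⟩ := hφ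
  rw [eq_C_of_degree_le_zero hle, aeval_C] at hφ0 hnot
  exact hnot (isResiduallyAlgebraic_algebraMap fun h0 => hφ0 (by rw [h0, map_zero]))

/-- Euclidean division by `φ` produces the `φ`-adic expansion of `p`; among its terms, those of
least value have distinct powers of `φ` and add up to the leading monomial times `1 + n`. -/
theorem exists_hasLeadingMonomial (hφ : IsKeyPolynomial k V y φ)
    {N : NonUnitalSubsemiring (ResidueField V)}
    (hN : ContainsMonomialResidues k K N (aeval y φ)) {p : K[X]} (hp : aeval y p ≠ 0) :
    ∃ i ≥ 0, HasLeadingMonomial k K N (aeval y φ) (aeval y p) i := by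
  have hz := hφ.aeval_ne_zero
  induction hd : p.degree using WellFoundedLT.induction generalizing p with
  | ind d ih =>
    subst hd
    have hp0 : p ≠ 0 := by
      rintro rfl
      exact hp (map_zero _)
    have hφ0 : φ ≠ 0 := ne_zero_of_degree_gt hφ.degree_pos
    have hdiv : aeval y p = aeval y φ * aeval y (p / φ) + aeval y (p % φ) := by
      rw [← map_mul, ← map_add, EuclideanDomain.div_add_mod]
    have hmod : aeval y (p % φ) ≠ 0 → IsResiduallyAlgebraic k K V (aeval y (p % φ)) :=
      hφ.isResiduallyAlgebraic_of_degree_lt _ (degree_mod_lt p hφ0)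
    by_cases hq : aeval y (p / φ) = 0
    · rw [hq, mul_zero, zero_add] at hdiv
      rw [hdiv] at hp ⊢
      exact ⟨0, le_rfl, (hmod hp).hasLeadingMonomial⟩
    obtain ⟨i, hi, hlead⟩ := ih _ (degree_div_lt hp0 hφ.degree_pos) hq rfl
    have hlead' := hlead.mul_left hz
    by_cases hr : aeval y (p % φ) = 0
    · rw [hr, add_zero] at hdiv
      exact ⟨i + 1, by positivity, hdiv ▸ hlead'⟩
    rw [hdiv]
    rcases hlead'.add_residuallyAlgebraic hN hz (by positivity) (hmod hr) with h | h
    · exact ⟨0, le_rfl, h⟩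
    · exact ⟨i + 1, by positivity, h⟩

/-- If the values of the powers of `φ` were independent of the residually algebraic elements, every
element would be a monomial up to a factor with residue `1`, and no residue would be
transcendental. -/
theorem unitExponents_ne_bot (hφ : IsKeyPolynomial k V y φ) (hK : HasAlgebraicResidues k K V)
    (hy : IntermediateField.adjoin K {y} = ⊤) (hκ : ¬ Algebra.IsAlgebraic k (ResidueField V)) :
    unitExponents k K V hφ.aeval_ne_zero ≠ ⊥ := by
  intro hbot
  have hzero : ∀ {i : ℤ} {w : L} {b : ResidueField V}, IsResiduallyAlgebraic k K V w → b ≠ 0 →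
      HasResidue V (aeval y φ ^ i * w) b → i = 0 := by
    intro i w b hw hb hres
    have hi : i ∈ unitExponents k K V hφ.aeval_ne_zero := ⟨w, hw, b, hb, hres⟩
    rwa [hbot, AddSubgroup.mem_bot] at hi
  have hN : ContainsMonomialResidues k K (V := V) ⊥ (aeval y φ) :=
    fun i hi w hw b hb hres => absurd (hzero hw hb hres) hi.ne'
  have hN1 : ∀ n ∈ (⊥ : NonUnitalSubsemiring (ResidueField V)), 1 + n ≠ 0 := by
    rintro n rfl
    simp
  refine hκ ⟨fun b => ?_⟩
  rcases eq_or_ne b 0 with rfl | hb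
  · exact isAlgebraic_zero
  obtain ⟨p, q, hpq⟩ := exists_hasResidue_aeval_div hy b
  obtain ⟨hp, hq⟩ := div_ne_zero_iff.1 (hpq.ne_zero hb)
  obtain ⟨i, -, hi⟩ := hφ.exists_hasLeadingMonomial hN hp
  obtain ⟨j, -, hj⟩ := hφ.exists_hasLeadingMonomial hN hq
  obtain ⟨w, hw, _, rfl, _, rfl, hres⟩ := hi.exists_hasResidue_div hN1 hφ.aeval_ne_zero hj hpq
  rw [add_zero, mul_one, div_one] at hres
  rw [hzero hw hb hres, zpow_zero, one_mul] at hres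
  exact hw.isAlgebraic hK hres

end IsKeyPolynomial

end KeyPolynomials

section RuledResidueField

theorem exists_aeval_eq_of_mem_nonUnitalAdjoin {R A : Type*} [CommSemiring R] [Semiring A]
    [Algebra R A] {t n : A} (hn : n ∈ NonUnitalAlgebra.adjoin R {t}) :
    ∃ P : R[X], P.coeff 0 = 0 ∧ aeval t P = n := by
  induction hn using NonUnitalAlgebra.adjoin_induction with
  | mem _ h => exact ⟨X, coeff_X_zero, by rw [aeval_X, Set.mem_singleton_iff.1 h]⟩
  | add _ _ _ _ hP hQ =>
    obtain ⟨P, hP, rfl⟩ := hP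
    obtain ⟨Q, hQ, rfl⟩ := hQ
    exact ⟨P + Q, by rw [coeff_add, hP, hQ, add_zero], map_add _ _ _⟩
  | zero => exact ⟨0, coeff_zero 0, map_zero _⟩
  | mul _ _ _ _ hP hQ =>
    obtain ⟨P, hP, rfl⟩ := hP
    obtain ⟨Q, -, rfl⟩ := hQ
    exact ⟨P * Q, by rw [mul_coeff_zero, hP, zero_mul], map_mul _ _ _⟩
  | smul r _ _ hP =>
    obtain ⟨P, hP, rfl⟩ := hP
    exact ⟨r • P, by rw [coeff_smul, hP, smul_zero], map_smul _ _ _⟩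

theorem one_add_ne_zero_of_mem_nonUnitalAdjoin {R A : Type*} [CommRing R] [Nontrivial R] [Ring A]
    [Algebra R A] {t n : A} (ht : Transcendental R t) (hn : n ∈ NonUnitalAlgebra.adjoin R {t}) :
    1 + n ≠ 0 := by
  obtain ⟨P, hP, rfl⟩ := exists_aeval_eq_of_mem_nonUnitalAdjoin hn
  intro h0
  have hP1 : 1 + P = 0 := transcendental_iff.1 ht _ (by rwa [map_add, map_one])
  simpa [hP] using congrArg (coeff · 0) hP1

theorem pow_succ_mem_nonUnitalAdjoin {R A : Type*} [CommSemiring R] [Semiring A] [Algebra R A]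
    (t : A) (n : ℕ) : t ^ (n + 1) ∈ NonUnitalAlgebra.adjoin R {t} := by
  have ht : t ∈ NonUnitalAlgebra.adjoin R {t} := NonUnitalAlgebra.self_mem_adjoin_singleton R t
  induction n with
  | zero => rwa [zero_add, pow_one]
  | succ n ih => exact pow_succ t (n + 1) ▸ mul_mem ih ht

variable {k K L : Type*} [Field k] [Field K] [Field L] [Algebra K L] {V : ValuationSubring L}
  [Algebra k (ResidueField V)]

namespace IsMonomialGenerator

variable {y w : L} {φ : K[X]} {e : ℕ} {t : ResidueField V}

theorem containsMonomialResidues {z : L} {hz : z ≠ 0} (h : IsMonomialGenerator k K V hz e w t)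
    (hK : HasAlgebraicResidues k K V) :
    ContainsMonomialResidues k K (NonUnitalAlgebra.adjoin
      (algebraicClosure k (ResidueField V)) {t}).toNonUnitalSubsemiring z := by
  intro i hi v hv b hb hres
  obtain ⟨β, m, rfl, rfl⟩ := h.exists_eq_mul_zpow hK hv hb hres
  obtain ⟨n, rfl⟩ := Int.eq_succ_of_zero_lt (pos_of_mul_pos_right hi e.cast_nonneg)
  rw [← Nat.cast_succ, zpow_natCast]
  rw [NonUnitalSubalgebra.mem_toNonUnitalSubsemiring]
  exact SMulMemClass.smul_mem β (pow_succ_mem_nonUnitalAdjoin t n)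

theorem adjoin_eq_top {hz : aeval y φ ≠ 0} (h : IsMonomialGenerator k K V hz e w t)
    (hφ : IsKeyPolynomial k V y φ) (hK : HasAlgebraicResidues k K V)
    (hy : IntermediateField.adjoin K {y} = ⊤)
    (ht : Transcendental (algebraicClosure k (ResidueField V)) t) :
    IntermediateField.adjoin (algebraicClosure k (ResidueField V)) {t} = ⊤ := by
  refine eq_top_iff.2 fun b _ => ?_
  rcases eq_or_ne b 0 with rfl | hb
  · exact zero_mem _
  have hN := h.containsMonomialResidues hK
  have hN1 : ∀ n ∈ NonUnitalAlgebra.adjoin (algebraicClosure k (ResidueField V)) {t}, 1 + n ≠ 0 :=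
    fun n => one_add_ne_zero_of_mem_nonUnitalAdjoin ht
  have hmem : ∀ n ∈ NonUnitalAlgebra.adjoin (algebraicClosure k (ResidueField V)) {t},
      1 + n ∈ IntermediateField.adjoin (algebraicClosure k (ResidueField V)) {t} := fun n hn =>
    add_mem (one_mem _) (IntermediateField.algebra_adjoin_le_adjoin _ _
      (NonUnitalAlgebra.adjoin_le_algebra_adjoin _ _ hn))
  obtain ⟨p, q, hpq⟩ := exists_hasResidue_aeval_div hy b
  obtain ⟨hp, hq⟩ := div_ne_zero_iff.1 (hpq.ne_zero hb)
  obtain ⟨i, -, hi⟩ := hφ.exists_hasLeadingMonomial hN hp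
  obtain ⟨j, -, hj⟩ := hφ.exists_hasLeadingMonomial hN hq
  obtain ⟨v, hv, n, hn, n', hn', hres⟩ := hi.exists_hasResidue_div hN1 hφ.aeval_ne_zero hj hpq
  obtain ⟨β, m, -, hβ⟩ := h.exists_eq_mul_zpow hK hv
    (div_ne_zero (mul_ne_zero hb (hN1 n' hn')) (hN1 n hn)) hres
  have hb_eq : b = β * t ^ m * (1 + n) / (1 + n') := by
    rw [← hβ, div_mul_cancel₀ _ (hN1 n hn), mul_div_cancel_right₀ _ (hN1 n' hn')]
  rw [hb_eq]
  exact div_mem (mul_mem (mul_mem (IntermediateField.algebraMap_mem _ β)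
    (zpow_mem (IntermediateField.mem_adjoin_simple_self _ t) m)) (hmem n hn)) (hmem n' hn')

theorem mem_adjoin_of_hasResidue_aeval {hz : aeval y φ ≠ 0}
    (h : IsMonomialGenerator k K V hz e w t) (hφ : IsKeyPolynomial k V y φ) (he : 0 < e)
    (hK : HasAlgebraicResidues k K V)
    (ht : Transcendental (algebraicClosure k (ResidueField V)) t) {p : K[X]} {b : ResidueField V}
    (hpb : HasResidue V (aeval y p) b) :
    b ∈ Algebra.adjoin (algebraicClosure k (ResidueField V)) {t} := by
  rcases eq_or_ne b 0 with rfl | hb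
  · exact zero_mem _
  have hp := hpb.ne_zero hb
  obtain ⟨i, hi, v, n, hv, hn, hres⟩ :=
    hφ.exists_hasLeadingMonomial (h.containsMonomialResidues hK) hp
  have hn1 : 1 + n ≠ 0 := one_add_ne_zero_of_mem_nonUnitalAdjoin ht hn
  have hmon : HasResidue V (aeval y φ ^ i * v) (b / (1 + n)) := by
    simpa only [div_div_cancel₀ hp] using hpb.div hres hn1
  obtain ⟨β, m, rfl, hβ⟩ := h.exists_eq_mul_zpow hK hv (div_ne_zero hb hn1) hmon
  obtain ⟨m, rfl⟩ := Int.eq_ofNat_of_zero_le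
    (nonneg_of_mul_nonneg_right hi (Int.natCast_pos.2 he))
  rw [← div_mul_cancel₀ b hn1, hβ, zpow_natCast]
  exact mul_mem (mul_mem (Subalgebra.algebraMap_mem _ β)
    (pow_mem (Algebra.self_mem_adjoin_singleton _ t) m))
    (add_mem (one_mem _) (NonUnitalAlgebra.adjoin_le_algebra_adjoin _ _ hn))

end IsMonomialGenerator

theorem exists_ruling_residueField {y : L} (hK : HasAlgebraicResidues k K V)
    (hy : IntermediateField.adjoin K {y} = ⊤) (hκ : ¬ Algebra.IsAlgebraic k (ResidueField V)) :
    ∃ t : ResidueField V, Transcendental k t ∧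
      IntermediateField.adjoin (algebraicClosure k (ResidueField V)) {t} = ⊤ ∧
      ∀ g ∈ Algebra.adjoin K {y}, ∀ b, HasResidue V g b →
        b ∈ Algebra.adjoin (algebraicClosure k (ResidueField V)) {t} := by
  obtain ⟨φ, hφ⟩ := exists_isKeyPolynomial hK hy hκ
  obtain ⟨e, w, t, h⟩ := exists_isMonomialGenerator (k := k) (K := K) (V := V) hφ.aeval_ne_zero
  have he : 0 < e := h.pos (hφ.unitExponents_ne_bot hK hy hκ)
  have ht : Transcendental k t := h.transcendental he hφ.not_isResiduallyAlgebraic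
  have ht' : Transcendental (algebraicClosure k (ResidueField V)) t :=
    fun halg => ht (halg.restrictScalars k)
  refine ⟨t, ht, h.adjoin_eq_top hφ hK hy ht', fun g hg b hgb => ?_⟩
  rw [Algebra.adjoin_singleton_eq_range_aeval] at hg
  obtain ⟨p, rfl⟩ := hg
  exact h.mem_adjoin_of_hasResidue_aeval hφ he hK ht' hgb

end RuledResidueField

section TwoGenerators

variable {k L : Type*} [Field k] [Field L] [Algebra k L] {V : ValuationSubring L}

theorem adjoin_subset_valuationSubring {R : Type*} [CommSemiring R] [Algebra R L]
    (hR : ∀ c : R, algebraMap R L c ∈ V) {s : Set L} (hs : s ⊆ V) :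
    (Algebra.adjoin R s : Set L) ⊆ V :=
  Algebra.adjoin_le (S := { V.toSubring with algebraMap_mem' := hR }) hs

theorem exists_isCoprime_aeval_div_of_mem_adjoin {s c : L} (hc : c ∈ k⟮s⟯) (hc0 : c ≠ 0) :
    ∃ p q : k[X], IsCoprime p q ∧ aeval s q ≠ 0 ∧ c = aeval s p / aeval s q := by
  classical
  obtain ⟨p, q, rfl⟩ := (IntermediateField.mem_adjoin_simple_iff k c).1 hc
  have hq := (div_ne_zero_iff.1 hc0).2
  have hq0 : q ≠ 0 := by
    rintro rfl
    exact hq (map_zero _)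
  set d := gcd p q
  have hp_eq : aeval s p = aeval s d * aeval s (p / d) := by
    rw [← map_mul, EuclideanDomain.mul_div_cancel' (gcd_ne_zero_of_right hq0) (gcd_dvd_left p q)]
  have hq_eq : aeval s q = aeval s d * aeval s (q / d) := by
    rw [← map_mul, EuclideanDomain.mul_div_cancel' (gcd_ne_zero_of_right hq0) (gcd_dvd_right p q)]
  obtain ⟨hd, hqd⟩ := mul_ne_zero_iff.1 (hq_eq ▸ hq)
  exact ⟨p / d, q / d, isCoprime_div_gcd_div_gcd hq0, hqd, by
    rw [hp_eq, hq_eq, mul_div_mul_left _ _ hd]⟩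

variable [Algebra k (ResidueField V)]

theorem hasAlgebraicResidues_adjoin_simple
    (hk : ∀ c : k, HasResidue V (algebraMap k L c) (algebraMap k _ c)) {s : L}
    (hs : HasResidue V s 0) : HasAlgebraicResidues k k⟮s⟯ V := by
  intro c a hca
  rcases eq_or_ne a 0 with rfl | ha
  · exact isAlgebraic_zero
  obtain ⟨p, q, hpq, hq, hc⟩ := exists_isCoprime_aeval_div_of_mem_adjoin c.2 (hca.ne_zero ha)
  have hres : a * aeval 0 q = aeval (0 : ResidueField V) p := by
    refine (hca.mul (hs.aeval hk q)).unique ?_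
    rw [show algebraMap k⟮s⟯ L c = aeval s p / aeval s q from hc, div_mul_cancel₀ _ hq]
    exact hs.aeval hk p
  rw [← coeff_zero_eq_aeval_zero', ← coeff_zero_eq_aeval_zero'] at hres
  have hq0 : q.coeff 0 ≠ 0 := fun hq0 => by
    rw [hq0, map_zero, mul_zero, eq_comm, map_eq_zero] at hres
    exact not_isUnit_X (hpq.isUnit_of_dvd' (X_dvd_iff.2 hres) (X_dvd_iff.2 hq0))
  rw [eq_div_of_mul_eq ((map_ne_zero (algebraMap k (ResidueField V))).2 hq0) hres, ← map_div₀]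
  exact isAlgebraic_algebraMap _

theorem exists_ruling_residueField_of_notMem {x y : L} (hxy : k⟮x, y⟯ = ⊤)
    (hk : ∀ c : k, HasResidue V (algebraMap k L c) (algebraMap k _ c)) (hx : x ∉ V)
    (hκ : ¬ Algebra.IsAlgebraic k (ResidueField V)) :
    ∃ t : ResidueField V, Transcendental k t ∧
      IntermediateField.adjoin (algebraicClosure k (ResidueField V)) {t} = ⊤ ∧
      ∀ g ∈ Algebra.adjoin k {x, y}, ∀ b, HasResidue V g b →
        b ∈ Algebra.adjoin (algebraicClosure k (ResidueField V)) {t} := by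
  have hxK : x ∈ k⟮x⁻¹⟯ := inv_mem_iff.1 (IntermediateField.mem_adjoin_simple_self k x⁻¹)
  have hK : HasAlgebraicResidues k k⟮x⁻¹⟯ V :=
    hasAlgebraicResidues_adjoin_simple hk (.inv_of_notMem hx)
  have hy : IntermediateField.adjoin k⟮x⁻¹⟯ {y} = ⊤ := by
    rw [← IntermediateField.restrictScalars_eq_top_iff (K := k), eq_top_iff, ← hxy,
      IntermediateField.adjoin_le_iff, Set.pair_subset_iff]
    exact ⟨IntermediateField.algebraMap_mem _ (⟨x, hxK⟩ : k⟮x⁻¹⟯),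
      IntermediateField.mem_adjoin_simple_self _ y⟩
  have hle : Algebra.adjoin k {x, y} ≤ (Algebra.adjoin k⟮x⁻¹⟯ {y}).restrictScalars k := by
    rw [Algebra.adjoin_le_iff, Set.pair_subset_iff]
    exact ⟨Subalgebra.algebraMap_mem _ (⟨x, hxK⟩ : k⟮x⁻¹⟯), Algebra.self_mem_adjoin_singleton _ y⟩
  obtain ⟨t, ht, htop, hpoly⟩ := exists_ruling_residueField hK hy hκ
  exact ⟨t, ht, htop, fun g hg => hpoly g (hle hg)⟩

theorem mainTheorem3_general {x y : L} (hxy : k⟮x, y⟯ = ⊤)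
    (hk : ∀ c : k, HasResidue V (algebraMap k L c) (algebraMap k _ c))
    (hV : ¬ (Algebra.adjoin k {x, y} : Set L) ⊆ V)
    (hκ : ¬ Algebra.IsAlgebraic k (ResidueField V)) :
    ∃ t : ResidueField V, Transcendental k t ∧
      IntermediateField.adjoin (algebraicClosure k (ResidueField V)) {t} = ⊤ ∧
      ∀ g ∈ Algebra.adjoin k {x, y}, ∀ b, HasResidue V g b →
        b ∈ Algebra.adjoin (algebraicClosure k (ResidueField V)) {t} := by
  have hkV : ∀ c : k, algebraMap k L c ∈ V := fun c => (hk c).elim fun v hv => hv.1 ▸ v.2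
  by_cases hx : x ∈ V
  · have hy : y ∉ V := fun hy =>
      hV (adjoin_subset_valuationSubring hkV (Set.pair_subset_iff.2 ⟨hx, hy⟩))
    rw [Set.pair_comm] at hxy ⊢
    exact exists_ruling_residueField_of_notMem hxy hk hy hκ
  · exact exists_ruling_residueField_of_notMem hxy hk hx hκ

end TwoGenerators

section RationalFunctions

variable (k : Type*) [Field k]

theorem range_toRat : Set.range (toRat (k := k)) =
    Algebra.adjoin k {toRat (.X 0 : MvPolynomial (Fin 2) k), toRat (.X 1)} := by
  have hX : Set.range (MvPolynomial.X : Fin 2 → MvPolynomial (Fin 2) k) = {.X 0, .X 1} := by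
    ext p
    simp only [Set.mem_range, Fin.exists_fin_two, Set.mem_insert_iff, Set.mem_singleton_iff,
      eq_comm]
  have hmap := AlgHom.map_adjoin (IsScalarTower.toAlgHom k (MvPolynomial (Fin 2) k) (RatFunc₂ k))
    (Set.range MvPolynomial.X)
  rw [MvPolynomial.adjoin_range_X, Algebra.map_top, hX, Set.image_pair] at hmap
  exact congrArg SetLike.coe hmap

theorem adjoin_toRat_X_eq_top :
    k⟮toRat (.X 0 : MvPolynomial (Fin 2) k), toRat (.X 1)⟯ = ⊤ := by
  have hmem : ∀ p : MvPolynomial (Fin 2) k, toRat p ∈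
      k⟮toRat (.X 0 : MvPolynomial (Fin 2) k), toRat (.X 1)⟯ := fun p =>
    IntermediateField.algebra_adjoin_le_adjoin _ _ ((range_toRat k).le ⟨p, rfl⟩)
  refine eq_top_iff.2 fun u _ => ?_
  obtain ⟨p, q, -, rfl⟩ := IsFractionRing.div_surjective (MvPolynomial (Fin 2) k) u
  exact div_mem (hmem p) (hmem q)

end RationalFunctions

theorem mainTheorem3 {k : Type*} [Field k] (f : MvPolynomial (Fin 2) k)
    (hf : f ∉ Set.range (MvPolynomial.C : k →+* MvPolynomial (Fin 2) k))
    (V : ValuationSubring (RatFunc₂ k)) (hV : IsDicriticalDivisor f V) :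
    letI : Algebra k (IsLocalRing.ResidueField V) :=
      residueAlgebra k⟮toRat f⟯ V hV.adjoin_subset
    ∃ t : IsLocalRing.ResidueField V,
      Transcendental k t ∧
      IntermediateField.adjoin (algebraicClosure k (IsLocalRing.ResidueField V)) {t} = ⊤ ∧
      resPoly f V hV.adjoin_subset ∈
        Algebra.adjoin (algebraicClosure k (IsLocalRing.ResidueField V)) {t} := by
  let _ : Algebra k (IsLocalRing.ResidueField V) := residueAlgebra k⟮toRat f⟯ V hV.adjoin_subset
  obtain ⟨t, ht, htop, hpoly⟩ := mainTheorem3_general (adjoin_toRat_X_eq_top k)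
    (fun c => ⟨constHom _ V hV.adjoin_subset c, rfl, rfl⟩) (range_toRat k ▸ hV.not_subset)
    fun h => hV.transcendental (h.isAlgebraic _)
  exact ⟨t, ht, htop, hpoly _ ((range_toRat k).le ⟨f, rfl⟩) _ ⟨_, rfl, rfl⟩⟩
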